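/- Let $\mathcal M_n$ denote the algebra of complex $n\times n$ matrices, and write $X\ge 0$ if $X$ is positive semidefinite, $X>0$ if moreover $X$ is invertible, and $X\ge Y$ if $X-Y\ge 0$. Let $f$ be a nonnegative matrix monotone function on $(0,\infty)$ with $f(1)=1$ (matrix monotone: $0<A\le B$ implies $f(A)\le f(B)$ for matrices of every size). The matrix mean $\sigma$ with representing function $f$ is $$A\,\sigma\,B=A^{1/2}f\bigl(A^{-1/2}BA^{-1/2}\bigr)A^{1/2}\quad (A,B>0),\qquad A\,\sigma\,B=\lim_{\varepsilon\downarrow0}\,(A+\varepsilon I)\,\sigma\,(B+\varepsilon I)\quad(A,B\ge0),$$ and its transpose $\sigma^{o}$ is $A\,\sigma^{o}\,B=B\,\sigma\,A$. For $\alpha\in[0,1]$, the weighted geometric mean $\sharp_\alpha$ is the matrix mean with $f(t)=t^\alpha$. Let $\Phi:\mathcal M_q\times\mathcal M_q\to\mathcal M_p$ be bilinear over $\mathbb C$, positive ($\Phi(A,B)\ge0$ whenever $A,B\ge0$) and unital ($\Phi(I,I)=I$), and let $A,B\in\mathcal M_q$ be positive semidefinite. (i) Let $\sigma$ be a matrix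 mean whose representing function $f$ is continuous and super-multiplicative on $(0,\infty)$, that is, $f(xy)\ge f(x)f(y)$ for all $x,y>0$, and is not affine there. Then the limits defining $A\,\sigma\,B$ and $A\,\sigma^{o}\,B$ exist and $$\Phi(A,B)+\Phi(B,A)\ \ge\ \Phi(A\,\sigma\,B,\;A\,\sigma^{o}\,B)+\Phi(A\,\sigma^{o}\,B,\;A\,\sigma\,B).$$ (ii) In particular, for every $\alpha\in[0,1]$ the limits defining $A\,\sharp_\alpha\,B$ and $A\,\sharp_{1-\alpha}\,B$ exist and $$\Phi(A,B)+\Phi(B,A)\ \ge\ \Phi(A\,\sharp_\alpha\,B,\;A\,\sharp_{1-\alpha}\,B)+\Phi(A\,\sharp_{1-\alpha}\,B,\;A\,\sharp_\alpha\,B).$$ -/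

import Mathlib

open Matrix Set Filter Topology
open scoped MatrixOrder ComplexOrder

/-- The algebra of complex `n × n` matrices. With `MatrixOrder` open, `X ≤ Y` is the Loewner
order: `Y - X` is positive semidefinite. -/
abbrev Mat (n : ℕ) : Type := Matrix (Fin n) (Fin n) ℂ

/-- `f` is matrix monotone on `(0, ∞)`: for matrices of every size with spectrum in `(0, ∞)`,
`A ≤ B` implies `f(A) ≤ f(B)` (functional calculus of Hermitian matrices). -/
def IsMatrixMonotone (f : ℝ → ℝ) : Prop :=
  ∀ (n : ℕ) (A B : Mat n), A.PosDef → B.PosDef → A ≤ B → cfc f A ≤ cfc f B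

/-- The representing functions of matrix means: nonnegative matrix monotone functions `f` on
`(0, ∞)` with `f 1 = 1`. Values of `f` outside `(0, ∞)` play no role. -/
structure IsRepresentingFunction (f : ℝ → ℝ) : Prop where
  nonneg : ∀ t : ℝ, 0 < t → 0 ≤ f t
  monotone : IsMatrixMonotone f
  map_one : f 1 = 1

/-- A continuous real function on `J` with `f (x y) ≥ f x f y` for all `x, y` in `J`. -/
structure IsSuperMultiplicativeOn (f : ℝ → ℝ) (J : Set ℝ) : Prop where
  continuousOn : ContinuousOn f J
  le_map_mul : ∀ x ∈ J, ∀ y ∈ J, f x * f y ≤ f (x * y)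

/-- `f` agrees with an affine function on `J`. -/
def IsAffineOn (f : ℝ → ℝ) (J : Set ℝ) : Prop :=
  ∃ a b : ℝ, ∀ t ∈ J, f t = a + b * t

/-- The square root of a positive semidefinite matrix. -/
noncomputable def matSqrt {n : ℕ} (A : Mat n) : Mat n := cfc Real.sqrt A

/-- `A^{1/2} f(A^{-1/2} B A^{-1/2}) A^{1/2}`, the mean of two strictly positive matrices. -/
noncomputable def meanFormula (f : ℝ → ℝ) {n : ℕ} (A B : Mat n) : Mat n :=
  matSqrt A * cfc f ((matSqrt A)⁻¹ * B * (matSqrt A)⁻¹) * matSqrt A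

/-- The strictly positive perturbation `(A + ε I) σ (B + ε I)` of the mean. -/
noncomputable def meanApprox (f : ℝ → ℝ) {n : ℕ} (A B : Mat n) (ε : ℝ) : Mat n :=
  meanFormula f (A + (ε : ℂ) • 1) (B + (ε : ℂ) • 1)

/-- The matrix mean `A σ B` with representing function `f`, for positive semidefinite `A, B`:
the limit of `(A + ε I) σ (B + ε I)` as `ε ↓ 0`. For strictly positive `A, B` it is
`meanFormula f A B`, see `matrixMean_eq_meanFormula`. -/
noncomputable def matrixMean (f : ℝ → ℝ) {n : ℕ} (A B : Mat n) : Mat n :=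
  limUnder (𝓝[>] (0 : ℝ)) (meanApprox f A B)

/-- The transpose of the mean: `A σᵒ B = B σ A`. -/
noncomputable def transposeMean (f : ℝ → ℝ) {n : ℕ} (A B : Mat n) : Mat n :=
  matrixMean f B A

/-- The limit that defines `A σ B` exists and its value is `matrixMean f A B`. -/
def MeanConverges (f : ℝ → ℝ) {n : ℕ} (A B : Mat n) : Prop :=
  Tendsto (meanApprox f A B) (𝓝[>] (0 : ℝ)) (𝓝 (matrixMean f A B))

/-- The weighted geometric mean `A ♯_α B`. -/
noncomputable def geomMean (α : ℝ) {n : ℕ} (A B : Mat n) : Mat n :=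
  matrixMean (fun t => t ^ α) A B

/-- A bilinear map is positive if it maps pairs of positive semidefinite matrices to positive
semidefinite matrices. -/
def IsPositiveBilinear {q p : ℕ} (Φ : Mat q →ₗ[ℂ] Mat q →ₗ[ℂ] Mat p) : Prop :=
  ∀ A B : Mat q, A.PosSemidef → B.PosSemidef → (Φ A B).PosSemidef

theorem spectrum_subset_of_posDef {n : ℕ} {A : Mat n} (hA : A.PosDef) :
    spectrum ℝ A ⊆ Ioi 0 := by
  intro x hx
  rw [hA.1.spectrum_real_eq_range_eigenvalues] at hx
  obtain ⟨i, rfl⟩ := hx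
  exact hA.eigenvalues_pos i

theorem matSqrt_isHermitian {n : ℕ} (A : Mat n) : (matSqrt A).IsHermitian :=
  cfc_predicate Real.sqrt A

theorem matSqrt_isUnit {n : ℕ} {A : Mat n} (hA : A.PosDef) : IsUnit (matSqrt A) := by
  have h : matSqrt A * matSqrt A = A := by
    have hsa : IsSelfAdjoint A := hA.1
    unfold matSqrt
    rw [← cfc_mul Real.sqrt Real.sqrt A]
    conv_rhs => rw [← cfc_id ℝ A hsa]
    exact cfc_congr fun x hx => Real.mul_self_sqrt (spectrum_subset_of_posDef hA hx).le
  have hu : IsUnit (matSqrt A * matSqrt A) := by rw [h]; exact hA.isUnit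
  rw [Matrix.isUnit_iff_isUnit_det] at hu ⊢
  rw [Matrix.det_mul] at hu
  exact isUnit_of_mul_isUnit_left hu

theorem posDef_conj_inv_matSqrt {n : ℕ} {A B : Mat n} (hA : A.PosDef) (hB : B.PosDef) :
    ((matSqrt A)⁻¹ * B * (matSqrt A)⁻¹).PosDef := by
  have hu : IsUnit (matSqrt A)⁻¹ := (Matrix.isUnit_nonsing_inv_iff).2 (matSqrt_isUnit hA)
  have hh : star ((matSqrt A)⁻¹) = (matSqrt A)⁻¹ := (matSqrt_isHermitian A).inv
  have := (hu.posDef_star_left_conjugate_iff (x := B)).2 hB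
  rwa [hh] at this

theorem posDef_perturb {n : ℕ} {A : Mat n} (hA : A.PosDef) {ε : ℝ} (hε : 0 ≤ ε) :
    (A + (ε : ℂ) • 1).PosDef :=
  hA.add_posSemidef (PosSemidef.one.smul (by exact_mod_cast hε))

open scoped Matrix.Norms.L2Operator in
theorem tendsto_cfc_of_posDef {n : ℕ} {f : ℝ → ℝ} (hf : ContinuousOn f (Ioi 0)) {A : Mat n}
    (hA : A.PosDef) {X : ℝ → Mat n} (hX : Tendsto X (𝓝[>] 0) (𝓝 A))
    (hXp : ∀ ε, 0 < ε → (X ε).PosDef) :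
    Tendsto (fun ε => cfc f (X ε)) (𝓝[>] 0) (𝓝 (cfc f A)) := by
  have hc : ContinuousOn (fun M : Mat n => cfc f M) {M | M.PosDef} := by
    refine ContinuousOn.cfc_of_mem_nhdsSet (𝕜 := ℝ) (s := Ioi 0) f ?_ continuousOn_id
      (fun M hM => hM.1) hf
    exact isOpen_Ioi.mem_nhdsSet.2 (iUnion₂_subset fun M hM => spectrum_subset_of_posDef hM)
  refine (hc A hA).tendsto.comp (tendsto_nhdsWithin_iff.2 ⟨hX, ?_⟩)
  filter_upwards [self_mem_nhdsWithin] with ε hε using hXp ε hε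

/-- On strictly positive matrices the mean is given by the usual formula. -/
theorem matrixMean_eq_meanFormula {n : ℕ} {f : ℝ → ℝ} (hf : ContinuousOn f (Ioi 0))
    {A B : Mat n} (hA : A.PosDef) (hB : B.PosDef) :
    matrixMean f A B = meanFormula f A B := by
  have key : ∀ C : Mat n, Tendsto (fun ε : ℝ => C + (ε : ℂ) • (1 : Mat n)) (𝓝[>] 0) (𝓝 C) := by
    intro C
    have : Continuous (fun ε : ℝ => C + (ε : ℂ) • (1 : Mat n)) := by fun_prop
    have h0 := (this.tendsto 0).mono_left (nhdsWithin_le_nhds (s := Ioi (0 : ℝ)))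
    simpa using h0
  have hs : Tendsto (fun ε : ℝ => matSqrt (A + (ε : ℂ) • (1 : Mat n))) (𝓝[>] 0)
      (𝓝 (matSqrt A)) :=
    tendsto_cfc_of_posDef Real.continuous_sqrt.continuousOn hA (key A)
      fun ε hε => posDef_perturb hA hε.le
  have hdet : (matSqrt A).det ≠ 0 :=
    ((Matrix.isUnit_iff_isUnit_det _).1 (matSqrt_isUnit hA)).ne_zero
  have hi : Tendsto (fun ε : ℝ => (matSqrt (A + (ε : ℂ) • (1 : Mat n)))⁻¹) (𝓝[>] 0)
      (𝓝 (matSqrt A)⁻¹) := by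
    have hc : ContinuousAt Ring.inverse (matSqrt A).det := by
      rw [Ring.inverse_eq_inv']
      exact continuousAt_inv₀ hdet
    exact (continuousAt_matrix_inv _ hc).tendsto.comp hs
  have hm := tendsto_cfc_of_posDef hf (posDef_conj_inv_matSqrt hA hB) ((hi.mul (key B)).mul hi)
    fun ε hε => posDef_conj_inv_matSqrt (posDef_perturb hA hε.le) (posDef_perturb hB hε.le)
  exact ((hs.mul hm).mul hs).limUnder_eq

/-!
For positive definite `A`, `B`, diagonalize `A^{-1/2} B A^{-1/2}`: this gives positive semidefinite
`Q i` and numbers `d i > 0` with `A = ∑ Q i`, `B = ∑ d i Q i`, `A σ B = ∑ f (d i) Q i`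
(`exists_meanFormula_eq_sum`), and `B σ A = ∑ d i f (1 / d i) Q i`, because the transpose of a mean
has the representing function `t f(1/t)` (`meanFormula_swap`). By bilinearity both sides of the
claim are combinations of the positive semidefinite matrices `Φ (Q i) (Q j)`, so it suffices to
compare coefficients:
`f(s) t f(1/t) + s f(1/s) f(t) ≤ s + t` for `s, t > 0` (`IsRepresentingFunction.cross_le`).
Super-multiplicativity bounds the left side by `t f(s/t) + s f(t/s)`, and with `x = s / t` what
remains is `f(x) + x f(1/x) ≤ 1 + x`, which is concavity of `f` at the point `1`.

Semidefinite `A`, `B` are reached through the limit `ε ↓ 0`, whose existence rests on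
`(A + εI) σ (B + εI)` being increasing in `ε` (`monotoneOn_meanApprox`) and nonnegative.

Concavity and this monotonicity both come from Jensen's inequality
`Kᴴ f(X) K + Lᴴ f(Y) L ≤ f(Kᴴ X K + Lᴴ Y L)` for `Kᴴ K + Lᴴ L = 1` (`IsMatrixMonotone.jensen`).
It is the isometric case `Vᴴ f(Z) V ≤ f(Vᴴ Z V)` for a block diagonal `Z`. With `E = V Vᴴ` one has
`Z ≤ W := (1 + η) E Z E + (1 + 1/η) (1 - E) Z (1 - E)`, and `W` commutes with `E`, so that monotonicity
gives `Vᴴ f(Z) V ≤ Vᴴ f(W) V = f((1 + η) Vᴴ Z V)`; then let `η ↓ 0`.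

For the weighted geometric means, `t ^ α` is matrix monotone by the Löwner–Heinz inequality and
multiplicative, and the transpose of `♯_α` is `♯_{1-α}`.
-/

/-! ### Functional calculus along intertwiners -/

/-- A rectangular matrix that intertwines two Hermitian matrices intertwines their functional
calculi: on the two finite spectra, `f` agrees with one polynomial. -/
theorem cfc_mul_eq_mul_cfc {m n : Type*} [Fintype m] [DecidableEq m] [Fintype n] [DecidableEq n]
    (f : ℝ → ℝ) {X : Matrix m m ℂ} {Y : Matrix n n ℂ} {V : Matrix m n ℂ}
    (hX : X.IsHermitian) (hY : Y.IsHermitian) (h : X * V = V * Y) :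
    cfc f X * V = V * cfc f Y := by
  classical
  set s : Finset ℝ := (X.finite_real_spectrum).toFinset ∪ (Y.finite_real_spectrum).toFinset
  set P := Lagrange.interpolate s id f
  have hP : ∀ x ∈ s, P.eval x = f x := fun x hx =>
    Lagrange.eval_interpolate_at_node (v := id) f (injOn_id _) hx
  have e1 : cfc f X = Polynomial.aeval X P := by
    rw [← cfc_polynomial P X hX]
    exact cfc_congr fun x hx => (hP x (by simp [s, hx])).symm
  have e2 : cfc f Y = Polynomial.aeval Y P := by
    rw [← cfc_polynomial P Y hY]
    exact cfc_congr fun x hx => (hP x (by simp [s, hx])).symm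
  rw [e1, e2]
  have hpow : ∀ k : ℕ, X ^ k * V = V * Y ^ k := by
    intro k
    induction k with
    | zero => simp
    | succ k ih => rw [pow_succ, pow_succ, Matrix.mul_assoc, h, ← Matrix.mul_assoc, ih,
        Matrix.mul_assoc]
  rw [Polynomial.aeval_eq_sum_range, Polynomial.aeval_eq_sum_range, Matrix.sum_mul,
    Matrix.mul_sum]
  simp [hpow]

/-- Matrix monotonicity for matrices indexed by an arbitrary finite type. -/
theorem IsMatrixMonotone.cfc_le_cfc {f : ℝ → ℝ} (hf : IsMatrixMonotone f) {m : Type*} [Fintype m]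
    [DecidableEq m] {X Y : Matrix m m ℂ} (hX : X.PosDef) (hY : Y.PosDef) (hXY : X ≤ Y) :
    cfc f X ≤ cfc f Y := by
  let e := Fintype.equivFin m
  set P : Matrix (Fin (Fintype.card m)) m ℂ := (1 : Matrix m m ℂ).submatrix e.symm id
  have hP : Pᴴ * P = 1 := by
    ext i j
    simp only [P, Matrix.mul_apply, conjTranspose_apply, submatrix_apply, Matrix.one_apply, id]
    rw [← e.sum_comp]
    simp [eq_comm]
  have hinj : ∀ Z : Matrix m m ℂ, Z.IsHermitian → cfc f Z = Pᴴ * cfc f (P * Z * Pᴴ) * P := by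
    intro Z hZ
    rw [Matrix.mul_assoc, cfc_mul_eq_mul_cfc f (Y := Z) (isHermitian_mul_mul_conjTranspose P hZ) hZ,
      ← Matrix.mul_assoc, hP, Matrix.one_mul]
    rw [Matrix.mul_assoc, hP, Matrix.mul_one]
  have hpos : ∀ Z : Matrix m m ℂ, Z.PosDef → (P * Z * Pᴴ).PosDef := by
    intro Z hZ
    convert hZ.submatrix (e := e.symm) e.symm.injective using 1
    ext i j
    simp [P, Matrix.mul_apply, Matrix.one_apply]
  rw [hinj X hX.1, hinj Y hY.1]
  have key := hf _ _ _ (hpos X hX) (hpos Y hY) (by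
    rw [Matrix.le_iff, ← Matrix.sub_mul, ← Matrix.mul_sub]
    exact (Matrix.le_iff.1 hXY).mul_mul_conjTranspose_same P)
  rw [Matrix.le_iff, ← Matrix.sub_mul, ← Matrix.mul_sub]
  exact (Matrix.le_iff.1 key).conjTranspose_mul_mul_same P

/-! ### Jensen's inequality for isometries -/

/-- For `E' = 1 - E`, the cross terms `E Z E' + E' Z E` of a positive semidefinite `Z` are dominated
by `η E Z E + η⁻¹ E' Z E'`: the difference is a congruence of `Z` by `√η E - √η⁻¹ E'`. -/
theorem le_pinching {m : Type*} [Fintype m] [DecidableEq m] {Z E : Matrix m m ℂ}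
    (hZ : Z.PosSemidef) (hE : E.IsHermitian) {η : ℝ} (hη : 0 < η) :
    Z ≤ ((1 + η : ℝ) : ℂ) • (E * Z * E) +
      ((1 + η⁻¹ : ℝ) : ℂ) • ((1 - E) * Z * (1 - E)) := by
  set r : ℂ := ((Real.sqrt η : ℝ) : ℂ)
  have hr : r * r = (η : ℂ) := by
    simp only [r]; rw [← Complex.ofReal_mul, Real.mul_self_sqrt hη.le]
  have hr0 : r ≠ 0 := by
    simp only [r]; exact_mod_cast (Real.sqrt_pos.2 hη).ne'
  have hrs : star r = r := by simp [r]
  have h := hZ.conjTranspose_mul_mul_same (r • E - r⁻¹ • (1 - E))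
  have hstar : (r • E - r⁻¹ • (1 - E))ᴴ = r • E - r⁻¹ • (1 - E) := by
    simp only [conjTranspose_sub, conjTranspose_smul, conjTranspose_one, hE.eq, star_inv₀, hrs]
  rw [hstar] at h
  rw [Matrix.le_iff]
  refine (congrArg PosSemidef ?_).mpr h
  have hinv : ((η⁻¹ : ℝ) : ℂ) = r⁻¹ * r⁻¹ := by
    rw [← mul_inv, hr]; push_cast; rfl
  have hdec : Z = (E + (1 - E)) * Z * (E + (1 - E)) := by simp
  refine (congrArg (fun T => _ - T) hdec).trans ?_
  generalize 1 - E = F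
  push_cast [Complex.ofReal_add] at hinv ⊢
  rw [hinv, ← hr]
  simp only [Matrix.add_mul, Matrix.mul_add, Matrix.sub_mul, Matrix.mul_sub, Matrix.smul_mul,
    Matrix.mul_smul, smul_sub, smul_smul, add_smul, one_smul, mul_inv_cancel₀ hr0,
    inv_mul_cancel₀ hr0]
  abel

theorem posDef_smul_ofReal {m : Type*} [Fintype m] [DecidableEq m] {A : Matrix m m ℂ}
    (hA : A.PosDef) {c : ℝ} (hc : 0 < c) : ((c : ℂ) • A).PosDef :=
  hA.smul (by exact_mod_cast hc)

/-- Compression by an isometry `V` raises a matrix monotone function, up to a dilation of the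
argument: `Z` is dominated by a matrix that the range of `V` reduces. -/
theorem IsMatrixMonotone.conj_isometry_le_smul {f : ℝ → ℝ} (hf : IsMatrixMonotone f)
    {m n : Type*} [Fintype m] [DecidableEq m] [Fintype n] [DecidableEq n]
    {Z : Matrix m m ℂ} (hZ : Z.PosDef) {V : Matrix m n ℂ} (hV : Vᴴ * V = 1) {η : ℝ} (hη : 0 < η) :
    Vᴴ * cfc f Z * V ≤ cfc f (((1 + η : ℝ) : ℂ) • (Vᴴ * Z * V)) := by
  set E := V * Vᴴ with hEdef
  have hE : E.IsHermitian := isHermitian_mul_conjTranspose_self V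
  have hEV : E * V = V := by rw [hEdef, Matrix.mul_assoc, hV, Matrix.mul_one]
  set W := ((1 + η : ℝ) : ℂ) • (E * Z * E) + ((1 + η⁻¹ : ℝ) : ℂ) • ((1 - E) * Z * (1 - E))
  have hZW : Z ≤ W := le_pinching hZ.posSemidef hE hη
  have hW : W.PosDef := by
    have := hZ.add_posSemidef (Matrix.le_iff.1 hZW)
    rwa [add_sub_cancel] at this
  have hWV : W * V = V * (((1 + η : ℝ) : ℂ) • (Vᴴ * Z * V)) := by
    simp only [W, Matrix.add_mul, Matrix.smul_mul, Matrix.mul_assoc, hEV, Matrix.sub_mul,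
      Matrix.one_mul, sub_self, Matrix.mul_zero, smul_zero, add_zero, Matrix.mul_smul]
    rw [hEdef, Matrix.mul_assoc]
  have hC : (((1 + η : ℝ) : ℂ) • (Vᴴ * Z * V)).IsHermitian := by
    have h1 : (Vᴴ * Z * V).IsHermitian := isHermitian_conjTranspose_mul_mul V hZ.1
    rw [Matrix.IsHermitian, conjTranspose_smul, h1.eq]
    simp
  have h := (Matrix.le_iff.1 (hf.cfc_le_cfc hZ hW hZW)).conjTranspose_mul_mul_same V
  rw [Matrix.mul_sub, Matrix.sub_mul, Matrix.mul_assoc Vᴴ (cfc f W),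
    cfc_mul_eq_mul_cfc f hW.1 hC hWV, ← Matrix.mul_assoc, hV, Matrix.one_mul] at h
  exact Matrix.le_iff.2 h

open scoped Matrix.Norms.L2Operator in
/-- The Loewner order is closed: a C⋆-algebra norm induces the topology of the matrices. -/
instance instOrderClosedTopologyMat {n : ℕ} : OrderClosedTopology (Mat n) :=
  inferInstanceAs (OrderClosedTopology (Matrix (Fin n) (Fin n) ℂ))

/-- Jensen's inequality for an isometry: the dilation by `1 + η` is removed by `η ↓ 0`. -/
theorem IsMatrixMonotone.conj_isometry_le {f : ℝ → ℝ} (hf : IsMatrixMonotone f)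
    (hc : ContinuousOn f (Ioi 0)) {m : Type*} [Fintype m] [DecidableEq m] {n : ℕ}
    {Z : Matrix m m ℂ} (hZ : Z.PosDef) {V : Matrix m (Fin n) ℂ} (hV : Vᴴ * V = 1) :
    Vᴴ * cfc f Z * V ≤ cfc f (Vᴴ * Z * V) := by
  have hpos : (Vᴴ * Z * V).PosDef := by
    refine hZ.conjTranspose_mul_mul_same fun x y hxy => ?_
    have := congrArg (Vᴴ *ᵥ ·) hxy
    simpa [Matrix.mulVec_mulVec, hV] using this
  have ht : Tendsto (fun η : ℝ => ((1 + η : ℝ) : ℂ) • (Vᴴ * Z * V)) (𝓝[>] 0)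
      (𝓝 (Vᴴ * Z * V)) := by
    have : Continuous (fun η : ℝ => ((1 + η : ℝ) : ℂ) • (Vᴴ * Z * V)) := by fun_prop
    simpa using (this.tendsto 0).mono_left (nhdsWithin_le_nhds (s := Ioi (0 : ℝ)))
  refine ge_of_tendsto (tendsto_cfc_of_posDef hc hpos ht fun η hη =>
    posDef_smul_ofReal hpos (by positivity)) ?_
  filter_upwards [self_mem_nhdsWithin] with η hη using hf.conj_isometry_le_smul hZ hV hη

/-- Jensen's inequality for two operator weights `Kᴴ K + Lᴴ L = 1`. -/
theorem IsMatrixMonotone.jensen {f : ℝ → ℝ} (hf : IsMatrixMonotone f)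
    (hc : ContinuousOn f (Ioi 0)) {n : ℕ} {X Y K L : Mat n} (hX : X.PosDef) (hY : Y.PosDef)
    (hKL : Kᴴ * K + Lᴴ * L = 1) :
    Kᴴ * cfc f X * K + Lᴴ * cfc f Y * L ≤ cfc f (Kᴴ * X * K + Lᴴ * Y * L) := by
  set Z : Matrix (Fin n ⊕ Fin n) (Fin n ⊕ Fin n) ℂ := fromBlocks X 0 0 Y
  have hZ : Z.PosDef := by
    refine PosDef.of_dotProduct_mulVec_pos (by
      rw [Matrix.IsHermitian, fromBlocks_conjTranspose, hX.1.eq, hY.1.eq]; simp [Z]) ?_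
    intro x hx
    obtain ⟨u, v, rfl⟩ : ∃ u v, x = Sum.elim u v := ⟨x ∘ Sum.inl, x ∘ Sum.inr, by simp⟩
    have e : star (Sum.elim u v) ⬝ᵥ Z *ᵥ Sum.elim u v = star u ⬝ᵥ X *ᵥ u + star v ⬝ᵥ Y *ᵥ v := by
      simp [Z, fromBlocks_mulVec, dotProduct]
    rw [e]
    by_cases hu : u = 0
    · have hv : v ≠ 0 := by
        rintro rfl
        apply hx
        ext i
        cases i <;> simp [hu]
      exact add_pos_of_nonneg_of_pos (hX.posSemidef.dotProduct_mulVec_nonneg u)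
        (hY.dotProduct_mulVec_pos hv)
    · exact add_pos_of_pos_of_nonneg (hX.dotProduct_mulVec_pos hu)
        (hY.posSemidef.dotProduct_mulVec_nonneg v)
  set ι₁ : Matrix (Fin n ⊕ Fin n) (Fin n) ℂ := fromRows 1 0
  set ι₂ : Matrix (Fin n ⊕ Fin n) (Fin n) ℂ := fromRows 0 1
  have h1 : cfc f Z * ι₁ = ι₁ * cfc f X := cfc_mul_eq_mul_cfc f hZ.1 hX.1 (by
    simp [Z, ι₁, fromBlocks_mul_fromRows, fromRows_mul])
  have h2 : cfc f Z * ι₂ = ι₂ * cfc f Y := cfc_mul_eq_mul_cfc f hZ.1 hY.1 (by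
    simp [Z, ι₂, fromBlocks_mul_fromRows, fromRows_mul])
  have hι : fromRows K L = ι₁ * K + ι₂ * L := by
    ext i j
    cases i <;> simp [ι₁, ι₂, fromRows_mul]
  have hV : (fromRows K L)ᴴ * fromRows K L = 1 := by
    rw [conjTranspose_fromRows_eq_fromCols_conjTranspose, fromCols_mul_fromRows, hKL]
  have key := hf.conj_isometry_le hc hZ hV
  have e1 : (fromRows K L)ᴴ * cfc f Z * fromRows K L = Kᴴ * cfc f X * K + Lᴴ * cfc f Y * L := by
    have : cfc f Z * fromRows K L = fromRows (cfc f X * K) (cfc f Y * L) := by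
      rw [hι, Matrix.mul_add, ← Matrix.mul_assoc, h1, ← Matrix.mul_assoc, h2]
      ext i j
      cases i <;> simp [ι₁, ι₂, fromRows_mul]
    rw [Matrix.mul_assoc, this, conjTranspose_fromRows_eq_fromCols_conjTranspose,
      fromCols_mul_fromRows]
    simp [Matrix.mul_assoc]
  have e2 : (fromRows K L)ᴴ * Z * fromRows K L = Kᴴ * X * K + Lᴴ * Y * L := by
    rw [Matrix.mul_assoc, conjTranspose_fromRows_eq_fromCols_conjTranspose]
    simp [Z, fromBlocks_mul_fromRows, fromCols_mul_fromRows, Matrix.mul_assoc]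
  rwa [e1, e2] at key

/-! ### Matrix means of positive definite matrices -/

theorem matSqrt_mul_self {n : ℕ} {A : Mat n} (hA : A.PosDef) : matSqrt A * matSqrt A = A := by
  have hsa : IsSelfAdjoint A := hA.1
  unfold matSqrt
  rw [← cfc_mul Real.sqrt Real.sqrt A]
  conv_rhs => rw [← cfc_id ℝ A hsa]
  exact cfc_congr fun x hx => Real.mul_self_sqrt (spectrum_subset_of_posDef hA hx).le

theorem matSqrt_mul_inv {n : ℕ} {A : Mat n} (hA : A.PosDef) : matSqrt A * (matSqrt A)⁻¹ = 1 :=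
  Matrix.mul_nonsing_inv _ ((Matrix.isUnit_iff_isUnit_det _).1 (matSqrt_isUnit hA))

theorem inv_mul_matSqrt {n : ℕ} {A : Mat n} (hA : A.PosDef) : (matSqrt A)⁻¹ * matSqrt A = 1 :=
  Matrix.nonsing_inv_mul _ ((Matrix.isUnit_iff_isUnit_det _).1 (matSqrt_isUnit hA))

theorem cfc_posSemidef {n : ℕ} {f : ℝ → ℝ} (hf : ∀ t : ℝ, 0 < t → 0 ≤ f t) {A : Mat n}
    (hA : A.PosDef) : (cfc f A).PosSemidef :=
  Matrix.nonneg_iff_posSemidef.1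
    (cfc_nonneg fun x hx => hf x (spectrum_subset_of_posDef hA hx))

theorem meanFormula_nonneg {n : ℕ} {f : ℝ → ℝ} (hf : ∀ t : ℝ, 0 < t → 0 ≤ f t) {A B : Mat n}
    (hA : A.PosDef) (hB : B.PosDef) : 0 ≤ meanFormula f A B := by
  have h := (cfc_posSemidef hf (posDef_conj_inv_matSqrt hA hB)).mul_mul_conjTranspose_same
    (matSqrt A)
  rw [(matSqrt_isHermitian A).eq] at h
  exact Matrix.nonneg_iff_posSemidef.2 h

/-- The instance `A σ B + δI σ δI ≤ (A + δI) σ (B + δI)` of the superadditivity of means; it is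
Jensen's inequality with weights `K = A^{1/2} (A + δI)^{-1/2}` and `L = δ^{1/2} (A + δI)^{-1/2}`. -/
theorem meanFormula_add_smul_one_le {n : ℕ} {f : ℝ → ℝ} (hf : IsMatrixMonotone f)
    (hc : ContinuousOn f (Ioi 0)) (h1 : f 1 = 1) {A B : Mat n} (hA : A.PosDef) (hB : B.PosDef)
    {δ : ℝ} (hδ : 0 ≤ δ) :
    meanFormula f A B + (δ : ℂ) • 1 ≤ meanFormula f (A + (δ : ℂ) • 1) (B + (δ : ℂ) • 1) := by
  have hA' := posDef_perturb hA hδ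
  set A' := A + (δ : ℂ) • (1 : Mat n) with hA'def
  have hSS := matSqrt_mul_self hA
  have hSi := matSqrt_mul_inv hA
  have hiS := inv_mul_matSqrt hA
  have hTT := matSqrt_mul_self hA'
  have hTi := matSqrt_mul_inv hA'
  have hiT := inv_mul_matSqrt hA'
  have hSh := matSqrt_isHermitian A
  have hTh := matSqrt_isHermitian A'
  have hXpos := posDef_conj_inv_matSqrt hA hB
  simp only [meanFormula]
  set S := matSqrt A
  set T := matSqrt A'
  have hTih : (T⁻¹)ᴴ = T⁻¹ := hTh.inv
  set r : ℂ := ((Real.sqrt δ : ℝ) : ℂ)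
  have hr : r * r = (δ : ℂ) := by
    simp only [r]; rw [← Complex.ofReal_mul, Real.mul_self_sqrt hδ]
  have hrs : star r = r := by simp [r]
  have hK : (S * T⁻¹)ᴴ = T⁻¹ * S := by rw [conjTranspose_mul, hSh.eq, hTih]
  have hL : (r • T⁻¹)ᴴ = r • T⁻¹ := by rw [conjTranspose_smul, hTih, hrs]
  have hTAT : T⁻¹ * A' * T⁻¹ = 1 := by
    rw [← hTT, ← Matrix.mul_assoc, hiT, Matrix.one_mul, hTi]
  -- Both weighted sums are congruences by `T⁻¹`.
  have key : ∀ M : Mat n, (S * T⁻¹)ᴴ * M * (S * T⁻¹) + (r • T⁻¹)ᴴ * 1 * (r • T⁻¹) =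
      T⁻¹ * (S * M * S + (δ : ℂ) • 1) * T⁻¹ := by
    intro M
    rw [hK, hL, ← hr]
    simp only [Matrix.mul_add, Matrix.add_mul, Matrix.mul_assoc, Matrix.mul_smul, Matrix.smul_mul,
      smul_smul, Matrix.mul_one]
  have hKL : (S * T⁻¹)ᴴ * (S * T⁻¹) + (r • T⁻¹)ᴴ * (r • T⁻¹) = 1 := by
    have := key 1
    simp only [Matrix.mul_one, hSS] at this
    rw [this, hTAT]
  have hJ := hf.jensen hc hXpos (PosDef.one (n := Fin n)) hKL
  have hone : cfc f (1 : Mat n) = 1 := by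
    rw [cfc_apply_one, h1, map_one]
  have hB0 : S * (S⁻¹ * B * S⁻¹) * S = B := by
    rw [Matrix.mul_assoc, Matrix.mul_assoc, hiS, Matrix.mul_one, ← Matrix.mul_assoc, hSi,
      Matrix.one_mul]
  rw [hone, key, key, hB0] at hJ
  have h := (Matrix.le_iff.1 hJ).mul_mul_conjTranspose_same T
  rw [hTh.eq, Matrix.mul_sub, Matrix.sub_mul] at h
  have e : ∀ M : Mat n, T * (T⁻¹ * M * T⁻¹) * T = M := by
    intro M
    rw [Matrix.mul_assoc, Matrix.mul_assoc, hiT, Matrix.mul_one, ← Matrix.mul_assoc, hTi,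
      Matrix.one_mul]
  rw [e] at h
  exact Matrix.le_iff.2 h

/-- The transpose of a mean has the representing function `t f(1/t)`: the matrix
`B^{1/2} A^{-1/2}` intertwines `B^{-1/2} A B^{-1/2}` with the inverse of `A^{-1/2} B A^{-1/2}`. -/
theorem meanFormula_swap {n : ℕ} (f : ℝ → ℝ) {A B : Mat n} (hA : A.PosDef) (hB : B.PosDef) :
    meanFormula f B A = meanFormula (fun t => t * f t⁻¹) A B := by
  have hSS := matSqrt_mul_self hA
  have hSi := matSqrt_mul_inv hA
  have hiS := inv_mul_matSqrt hA
  have hTT := matSqrt_mul_self hB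
  have hTi := matSqrt_mul_inv hB
  have hiT := inv_mul_matSqrt hB
  have hC := posDef_conj_inv_matSqrt hA hB
  have hD := posDef_conj_inv_matSqrt hB hA
  simp only [meanFormula]
  set S := matSqrt A
  set T := matSqrt B
  set C := S⁻¹ * B * S⁻¹ with hCdef
  have hspec : ∀ x ∈ spectrum ℝ C, x ≠ 0 := fun x hx => (spectrum_subset_of_posDef hC hx).ne'
  have hCid : cfc (fun t : ℝ => t) C = C := cfc_id' ℝ C hC.1
  have hfin : ∀ g : ℝ → ℝ, ContinuousOn g (spectrum ℝ C) := fun g =>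
    (C.finite_real_spectrum).continuousOn g
  have hinv : cfc (fun t : ℝ => t⁻¹) C * C = 1 := by
    have h := cfc_mul (fun t : ℝ => t⁻¹) (fun t : ℝ => t) C (hfin _) (hfin _)
    rw [hCid] at h
    rw [← h, ← cfc_one ℝ C hC.1]
    exact cfc_congr fun x hx => inv_mul_cancel₀ (hspec x hx)
  set C' := cfc (fun t : ℝ => t⁻¹) C
  have hCC : C = S⁻¹ * T * (T * S⁻¹) := by
    rw [hCdef, ← hTT]; simp only [Matrix.mul_assoc]
  have hCC' : C * C' = 1 := mul_eq_one_comm.1 hinv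
  have hTC : T * S⁻¹ * C' = T⁻¹ * S := by
    have : T⁻¹ * S * C = T * S⁻¹ := by
      rw [hCC]
      calc T⁻¹ * S * (S⁻¹ * T * (T * S⁻¹)) = T⁻¹ * (S * S⁻¹) * T * (T * S⁻¹) := by
            simp only [Matrix.mul_assoc]
        _ = T * S⁻¹ := by rw [hSi, Matrix.mul_one, hiT, Matrix.one_mul]
    rw [← this, Matrix.mul_assoc, hCC', Matrix.mul_one]
  have hint : (T⁻¹ * A * T⁻¹) * (T * S⁻¹) = (T * S⁻¹) * C' := by
    rw [hTC, ← hSS]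
    calc T⁻¹ * (S * S) * T⁻¹ * (T * S⁻¹) = T⁻¹ * S * S * (T⁻¹ * T) * S⁻¹ := by
          simp only [Matrix.mul_assoc]
      _ = T⁻¹ * S := by
          rw [hiT, Matrix.mul_one, Matrix.mul_assoc, hSi, Matrix.mul_one]
  have hf := cfc_mul_eq_mul_cfc (Y := C') f hD.1 (cfc_predicate _ C) hint
  have hcomp : cfc f C' = cfc (fun t => f t⁻¹) C :=
    (cfc_comp' f (fun t : ℝ => t⁻¹) C
      ((C.finite_real_spectrum.image _).continuousOn f) (hfin _) hC.1).symm
  rw [hcomp] at hf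
  have hprod : cfc (fun t => t * f t⁻¹) C = C * cfc (fun t => f t⁻¹) C := by
    rw [cfc_mul (fun t : ℝ => t) (fun t => f t⁻¹) C (hfin _) (hfin _), hCid]
  rw [hprod]
  calc T * cfc f (T⁻¹ * A * T⁻¹) * T
      = T * (cfc f (T⁻¹ * A * T⁻¹) * (T * S⁻¹)) * S := by
        simp only [Matrix.mul_assoc, hiS, Matrix.mul_one]
    _ = T * (T * S⁻¹ * cfc (fun t => f t⁻¹) C) * S := by rw [hf]
    _ = (S * S⁻¹) * T * (T * S⁻¹ * cfc (fun t => f t⁻¹) C) * S := by rw [hSi, Matrix.one_mul]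
    _ = S * (S⁻¹ * T * (T * S⁻¹) * cfc (fun t => f t⁻¹) C) * S := by
        simp only [Matrix.mul_assoc]
    _ = S * (C * cfc (fun t => f t⁻¹) C) * S := by rw [← hCC]

/-! ### Existence of the limit -/

theorem posDef_add_smul_one {n : ℕ} {A : Mat n} (hA : A.PosSemidef) {ε : ℝ} (hε : 0 < ε) :
    (A + (ε : ℂ) • 1).PosDef :=
  PosDef.posSemidef_add hA (posDef_smul_ofReal PosDef.one hε)

theorem monotoneOn_meanApprox {n : ℕ} {f : ℝ → ℝ} (hf : IsMatrixMonotone f)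
    (hc : ContinuousOn f (Ioi 0)) (h1 : f 1 = 1) {A B : Mat n} (hA : A.PosSemidef)
    (hB : B.PosSemidef) : MonotoneOn (meanApprox f A B) (Ioi 0) := by
  intro ε hε ε' _ hle
  have h := meanFormula_add_smul_one_le hf hc h1 (posDef_add_smul_one hA hε)
    (posDef_add_smul_one hB hε) (sub_nonneg.2 hle)
  have e : ∀ M : Mat n, M + (ε : ℂ) • 1 + ((ε' - ε : ℝ) : ℂ) • 1 = M + (ε' : ℂ) • 1 := by
    intro M
    rw [add_assoc, ← add_smul]
    push_cast
    rw [add_sub_cancel]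
  rw [e, e] at h
  refine le_trans (le_add_of_nonneg_right ?_) h
  exact Matrix.nonneg_iff_posSemidef.2
    (PosSemidef.one.smul (by exact_mod_cast sub_nonneg.2 hle))

open scoped Matrix.Norms.L2Operator in
/-- A nonnegative increasing family of matrices on `(0, ∞)` converges at `0`: it stays in a compact
ball near `0`, and any two cluster points bound each other. -/
theorem exists_tendsto_of_monotoneOn {n : ℕ} {M : ℝ → Mat n} (hM : MonotoneOn M (Ioi 0))
    (h0 : ∀ ε, 0 < ε → 0 ≤ M ε) : ∃ L, Tendsto M (𝓝[>] (0 : ℝ)) (𝓝 L) := by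
  have : ProperSpace (Mat n) := FiniteDimensional.proper ℂ _
  have hK : IsCompact (Metric.closedBall (0 : Mat n) ‖M 1‖) := isCompact_closedBall _ _
  have hsmall : ∀ ε : ℝ, 0 < ε → ∀ᶠ δ in 𝓝[>] (0 : ℝ), 0 < δ ∧ δ ≤ ε := by
    intro ε hε
    filter_upwards [Ioc_mem_nhdsGT hε] with δ hδ using hδ
  have hmem : ∀ᶠ ε in 𝓝[>] (0 : ℝ), M ε ∈ Metric.closedBall (0 : Mat n) ‖M 1‖ := by
    filter_upwards [hsmall 1 one_pos] with ε hε
    rw [mem_closedBall_zero_iff]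
    exact CStarAlgebra.norm_le_norm_of_nonneg_of_le (h0 ε hε.1) (hM hε.1 (mem_Ioi.2 one_pos) hε.2)
  have hle : ∀ L, MapClusterPt L (𝓝[>] (0 : ℝ)) M → ∀ ε, 0 < ε → L ≤ M ε := by
    intro L hL ε hε
    refine isClosed_Iic.mem_of_mapClusterPt hL ?_
    filter_upwards [hsmall ε hε] with δ hδ using hM hδ.1 hε hδ.2
  have hle2 : ∀ L L', MapClusterPt L (𝓝[>] (0 : ℝ)) M → MapClusterPt L' (𝓝[>] (0 : ℝ)) M →
      L ≤ L' := by
    intro L L' hL hL'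
    refine isClosed_Ici.mem_of_mapClusterPt hL' ?_
    filter_upwards [self_mem_nhdsWithin] with δ hδ using hle L hL δ hδ
  obtain ⟨L, -, hL⟩ := hK.exists_mapClusterPt_of_frequently hmem.frequently
  exact ⟨L, hK.tendsto_nhds_of_unique_mapClusterPt hmem fun L' _ hL' =>
    le_antisymm (hle2 _ _ hL' hL) (hle2 _ _ hL hL')⟩

theorem IsRepresentingFunction.meanConverges {f : ℝ → ℝ} (hf : IsRepresentingFunction f)
    (hc : ContinuousOn f (Ioi 0)) {n : ℕ} {A B : Mat n} (hA : A.PosSemidef) (hB : B.PosSemidef) :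
    MeanConverges f A B :=
  tendsto_nhds_limUnder <| exists_tendsto_of_monotoneOn
    (monotoneOn_meanApprox hf.monotone hc hf.map_one hA hB) fun _ hε =>
      meanFormula_nonneg hf.nonneg (posDef_add_smul_one hA hε) (posDef_add_smul_one hB hε)

/-! ### The inequality -/

/-- Jensen's inequality with the weights `1 / (1 + x)` and `x / (1 + x)` at `x` and `1 / x`. -/
theorem IsRepresentingFunction.add_mul_inv_le {f : ℝ → ℝ} (hf : IsRepresentingFunction f)
    (hc : ContinuousOn f (Ioi 0)) {x : ℝ} (hx : 0 < x) : f x + x * f x⁻¹ ≤ 1 + x := by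
  have hx1 : 0 < 1 + x := by positivity
  have hpos : ∀ t : ℝ, 0 < t → ((t : ℂ) • (1 : Mat 1)).PosDef := fun t ht =>
    posDef_smul_ofReal PosDef.one ht
  have hcfc : ∀ t : ℝ, cfc f ((t : ℂ) • (1 : Mat 1)) = ((f t : ℝ) : ℂ) • (1 : Mat 1) := by
    intro t
    have e : ∀ s : ℝ, (s : ℂ) • (1 : Mat 1) = algebraMap ℝ (Mat 1) s := by
      intro s
      rw [Algebra.algebraMap_eq_smul_one]
      ext i j
      simp
    rw [e, e, cfc_algebraMap]
  have hw : ∀ (w t : ℝ), 0 ≤ w →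
      (((Real.sqrt w : ℝ) : ℂ) • (1 : Mat 1))ᴴ * ((t : ℂ) • (1 : Mat 1)) *
      (((Real.sqrt w : ℝ) : ℂ) • (1 : Mat 1)) = ((w * t : ℝ) : ℂ) • (1 : Mat 1) := by
    intro w t h0
    rw [conjTranspose_smul, conjTranspose_one]
    simp only [Matrix.smul_mul, Matrix.mul_smul, Matrix.one_mul, smul_smul]
    congr 1
    rw [RCLike.star_def, Complex.conj_ofReal, ← Complex.ofReal_mul, ← Complex.ofReal_mul,
      mul_comm t, ← mul_assoc, Real.mul_self_sqrt h0]
  have hw1 : ∀ w : ℝ, 0 ≤ w → (((Real.sqrt w : ℝ) : ℂ) • (1 : Mat 1))ᴴ *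
      (((Real.sqrt w : ℝ) : ℂ) • (1 : Mat 1)) = (w : ℂ) • (1 : Mat 1) := by
    intro w h0
    simpa using hw w 1 h0
  have ha : 0 ≤ 1 / (1 + x) := by positivity
  have hb : 0 ≤ x / (1 + x) := by positivity
  have hJ := hf.monotone.jensen hc (hpos x hx) (hpos x⁻¹ (inv_pos.2 hx))
    (K := ((Real.sqrt (1 / (1 + x)) : ℝ) : ℂ) • (1 : Mat 1))
    (L := ((Real.sqrt (x / (1 + x)) : ℝ) : ℂ) • (1 : Mat 1)) (by
      rw [hw1 _ ha, hw1 _ hb, ← add_smul, ← Complex.ofReal_add, ← add_div, div_self hx1.ne']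
      simp)
  rw [hcfc, hcfc, hw _ _ ha, hw _ _ hb, hw _ _ ha, hw _ _ hb, ← add_smul, ← add_smul,
    ← Complex.ofReal_add, ← Complex.ofReal_add, hcfc,
    show 1 / (1 + x) * x + x / (1 + x) * x⁻¹ = 1 by field_simp; ring, hf.map_one] at hJ
  have h := (Matrix.le_iff.1 hJ).diag_nonneg (i := 0)
  simp only [Matrix.sub_apply, Matrix.smul_apply, Matrix.one_apply_eq, smul_eq_mul, mul_one,
    ← Complex.ofReal_sub, Complex.zero_le_real] at h
  have : (f x + x * f x⁻¹) / (1 + x) ≤ 1 := by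
    rw [sub_nonneg] at h
    refine le_trans (le_of_eq ?_) h
    ring
  rwa [div_le_one hx1] at this

/-- The scalar inequality behind the theorem: super-multiplicativity reduces it to the case of the
single variable `s / t`. -/
theorem IsRepresentingFunction.cross_le {f : ℝ → ℝ} (hf : IsRepresentingFunction f)
    (hm : IsSuperMultiplicativeOn f (Ioi 0)) {s t : ℝ} (hs : 0 < s) (ht : 0 < t) :
    f s * (t * f t⁻¹) + s * f s⁻¹ * f t ≤ t + s := by
  have h1 := hm.le_map_mul s hs t⁻¹ (inv_pos.2 ht)
  have h2 := hm.le_map_mul s⁻¹ (inv_pos.2 hs) t ht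
  have h3 := hf.add_mul_inv_le hm.continuousOn (x := s * t⁻¹) (by positivity)
  rw [mul_inv, inv_inv] at h3
  have e : t * (1 + s * t⁻¹) = t + s := by field_simp
  calc f s * (t * f t⁻¹) + s * f s⁻¹ * f t = t * (f s * f t⁻¹) + s * (f s⁻¹ * f t) := by ring
    _ ≤ t * f (s * t⁻¹) + s * f (s⁻¹ * t) := by gcongr
    _ = t * (f (s * t⁻¹) + s * t⁻¹ * f (s⁻¹ * t)) := by field_simp
    _ ≤ t * (1 + s * t⁻¹) := by gcongr
    _ = t + s := e

/-- Two positive definite matrices are simultaneously diagonal under a congruence, and so are all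
their means: `Q i` are the congruence images of the rank-one spectral projections of
`A^{-1/2} B A^{-1/2}`, and `d i` the eigenvalues. -/
theorem exists_meanFormula_eq_sum {n : ℕ} {A B : Mat n} (hA : A.PosDef) (hB : B.PosDef) :
    ∃ (d : Fin n → ℝ) (Q : Fin n → Mat n), (∀ i, 0 < d i) ∧ (∀ i, (Q i).PosSemidef) ∧
      ∀ f : ℝ → ℝ, meanFormula f A B = ∑ i, ((f (d i) : ℝ) : ℂ) • Q i := by
  have hC := posDef_conj_inv_matSqrt hA hB
  have hSh := matSqrt_isHermitian A
  simp only [meanFormula]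
  set S := matSqrt A
  set C := S⁻¹ * B * S⁻¹
  set U : Mat n := (hC.1.eigenvectorUnitary : Mat n)
  refine ⟨hC.1.eigenvalues, fun i => (S * U) * diagonal (Pi.single i 1) * (S * U)ᴴ,
    hC.eigenvalues_pos, fun i => ?_, fun f => ?_⟩
  · refine PosSemidef.mul_mul_conjTranspose_same (PosSemidef.diagonal ?_) _
    exact Pi.single_nonneg.2 zero_le_one
  · have hd : diagonal (fun i => ((f (hC.1.eigenvalues i) : ℝ) : ℂ)) =
        ∑ i, ((f (hC.1.eigenvalues i) : ℝ) : ℂ) • diagonal (Pi.single i (1 : ℂ)) := by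
      ext i j
      by_cases hij : i = j
      · subst hij; simp [Matrix.sum_apply, Pi.single_apply]
      · simp [Matrix.sum_apply, hij]
    have hcf : cfc f C = U * diagonal (fun i => ((f (hC.1.eigenvalues i) : ℝ) : ℂ)) * Uᴴ := by
      rw [hC.1.cfc_eq f, Matrix.IsHermitian.cfc, Unitary.conjStarAlgAut_apply]
      rfl
    rw [hcf, hd, conjTranspose_mul, hSh.eq]
    simp only [Matrix.mul_sum, Matrix.sum_mul, Matrix.mul_smul, Matrix.smul_mul, Matrix.mul_assoc]

/-- Bilinear expansion along the common congruence diagonalization leaves the positive semidefinite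
matrices `Φ (Q i) (Q j)` with the coefficients of the scalar inequality. -/
theorem IsPositiveBilinear.meanFormula_le {q p : ℕ} {Φ : Mat q →ₗ[ℂ] Mat q →ₗ[ℂ] Mat p}
    (hΦ : IsPositiveBilinear Φ) {f : ℝ → ℝ} (hf : IsRepresentingFunction f)
    (hm : IsSuperMultiplicativeOn f (Ioi 0)) {A B : Mat q} (hA : A.PosDef) (hB : B.PosDef) :
    Φ (meanFormula f A B) (meanFormula f B A) + Φ (meanFormula f B A) (meanFormula f A B)
      ≤ Φ A B + Φ B A := by
  obtain ⟨d, Q, hd, hQ, hsum⟩ := exists_meanFormula_eq_sum hA hB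
  have hBA := (meanFormula_swap f hA hB).trans (hsum _)
  have hC := posDef_conj_inv_matSqrt hA hB
  -- `A` and `B` are themselves the means with representing functions `1` and `t`.
  have hA1 : A = ∑ i, (((fun _ : ℝ => (1 : ℝ)) (d i) : ℝ) : ℂ) • Q i := by
    have h : cfc (fun _ : ℝ => (1 : ℝ)) ((matSqrt A)⁻¹ * B * (matSqrt A)⁻¹) = 1 :=
      cfc_const_one ℝ _ hC.1
    rw [← hsum (fun _ => 1), meanFormula, h, Matrix.mul_one, matSqrt_mul_self hA]
  have hB1 : B = ∑ i, (((fun t : ℝ => t) (d i) : ℝ) : ℂ) • Q i := by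
    have h : cfc (fun t : ℝ => t) ((matSqrt A)⁻¹ * B * (matSqrt A)⁻¹) =
        (matSqrt A)⁻¹ * B * (matSqrt A)⁻¹ := cfc_id' ℝ _ hC.1
    rw [← hsum (fun t => t), meanFormula, h, Matrix.mul_assoc, Matrix.mul_assoc,
      inv_mul_matSqrt hA, Matrix.mul_one, ← Matrix.mul_assoc, matSqrt_mul_inv hA, Matrix.one_mul]
  have hexp : ∀ u v : Fin q → ℝ, Φ (∑ i, (u i : ℂ) • Q i) (∑ i, (v i : ℂ) • Q i) =
      ∑ i, ∑ j, ((u i * v j : ℝ) : ℂ) • Φ (Q i) (Q j) := by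
    intro u v
    simp only [map_sum, map_smul, LinearMap.sum_apply, LinearMap.smul_apply, smul_smul,
      Complex.ofReal_mul, Finset.smul_sum]
    rw [Finset.sum_comm]
    simp only [mul_comm]
  rw [hBA, hsum f]
  conv_rhs => rw [hA1, hB1]
  simp only [hexp, ← Finset.sum_add_distrib, ← add_smul, ← Complex.ofReal_add]
  rw [Matrix.le_iff]
  simp only [← Finset.sum_sub_distrib, ← sub_smul, ← Complex.ofReal_sub]
  refine posSemidef_sum _ fun i _ => posSemidef_sum _ fun j _ => (hΦ _ _ (hQ i) (hQ j)).smul ?_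
  have := hf.cross_le hm (hd i) (hd j)
  rw [Complex.zero_le_real]
  linarith

theorem continuous_bilinear {q p : ℕ} (Φ : Mat q →ₗ[ℂ] Mat q →ₗ[ℂ] Mat p) :
    Continuous fun x : Mat q × Mat q => Φ x.1 x.2 := by
  have h : ∀ x : Mat q × Mat q, Φ x.1 x.2 = ∑ i, ∑ j, x.1 i j • Φ (Matrix.single i j 1) x.2 := by
    intro x
    conv_lhs => rw [Matrix.matrix_eq_sum_single x.1]
    simp only [map_sum, LinearMap.sum_apply]
    refine Finset.sum_congr rfl fun i _ => Finset.sum_congr rfl fun j _ => ?_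
    rw [← LinearMap.smul_apply, ← map_smul, Matrix.smul_single, smul_eq_mul, mul_one]
  simp only [h]
  refine continuous_finsetSum _ fun i _ => continuous_finsetSum _ fun j _ => ?_
  have hl : Continuous (Φ (Matrix.single i j 1)) := LinearMap.continuous_of_finiteDimensional _
  exact (continuous_fst.matrix_elem i j).smul (hl.comp continuous_snd)

theorem tendsto_add_smul_one {n : ℕ} (A : Mat n) :
    Tendsto (fun ε : ℝ => A + (ε : ℂ) • (1 : Mat n)) (𝓝[>] 0) (𝓝 A) := by
  have : Continuous (fun ε : ℝ => A + (ε : ℂ) • (1 : Mat n)) := by fun_prop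
  simpa using (this.tendsto 0).mono_left (nhdsWithin_le_nhds (s := Ioi (0 : ℝ)))

theorem IsPositiveBilinear.matrixMean_le {q p : ℕ} {Φ : Mat q →ₗ[ℂ] Mat q →ₗ[ℂ] Mat p}
    (hΦ : IsPositiveBilinear Φ) {f : ℝ → ℝ} (hf : IsRepresentingFunction f)
    (hm : IsSuperMultiplicativeOn f (Ioi 0)) {A B : Mat q} (hA : A.PosSemidef)
    (hB : B.PosSemidef) :
    Φ (matrixMean f A B) (matrixMean f B A) + Φ (matrixMean f B A) (matrixMean f A B)
      ≤ Φ A B + Φ B A := by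
  have lim : ∀ {X Y : ℝ → Mat q} {X₀ Y₀ : Mat q}, Tendsto X (𝓝[>] (0 : ℝ)) (𝓝 X₀) →
      Tendsto Y (𝓝[>] (0 : ℝ)) (𝓝 Y₀) →
      Tendsto (fun ε => Φ (X ε) (Y ε) + Φ (Y ε) (X ε)) (𝓝[>] (0 : ℝ)) (𝓝 (Φ X₀ Y₀ + Φ Y₀ X₀)) :=
    fun hX hY => (((continuous_bilinear Φ).tendsto _).comp (hX.prodMk_nhds hY)).add
      (((continuous_bilinear Φ).tendsto _).comp (hY.prodMk_nhds hX))
  refine le_of_tendsto_of_tendsto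
    (lim (hf.meanConverges hm.continuousOn hA hB) (hf.meanConverges hm.continuousOn hB hA))
    (lim (tendsto_add_smul_one A) (tendsto_add_smul_one B)) ?_
  filter_upwards [self_mem_nhdsWithin] with ε hε using
    hΦ.meanFormula_le hf hm (posDef_add_smul_one hA hε) (posDef_add_smul_one hB hε)

/-! ### Weighted geometric means -/

open scoped Matrix.Norms.L2Operator in
/-- The Löwner–Heinz inequality. -/
theorem isRepresentingFunction_rpow {α : ℝ} (hα : α ∈ Icc (0 : ℝ) 1) :
    IsRepresentingFunction fun t : ℝ => t ^ α where
  nonneg t ht := Real.rpow_nonneg ht.le α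
  monotone n A B hA hB hAB := by
    have hA0 : 0 ≤ A := Matrix.nonneg_iff_posSemidef.2 hA.posSemidef
    have hB0 : 0 ≤ B := Matrix.nonneg_iff_posSemidef.2 hB.posSemidef
    rw [← CFC.rpow_eq_cfc_real hA0, ← CFC.rpow_eq_cfc_real hB0]
    exact CFC.rpow_le_rpow hα hAB
  map_one := Real.one_rpow α

theorem isSuperMultiplicativeOn_rpow (α : ℝ) :
    IsSuperMultiplicativeOn (fun t : ℝ => t ^ α) (Ioi 0) where
  continuousOn := continuousOn_id.rpow_const fun _ hx => Or.inl (ne_of_gt hx)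
  le_map_mul _ hx _ hy := (Real.mul_rpow (le_of_lt hx) (le_of_lt hy)).ge

theorem meanFormula_congr {n : ℕ} {f g : ℝ → ℝ} (hfg : ∀ t, 0 < t → f t = g t) {A B : Mat n}
    (hA : A.PosDef) (hB : B.PosDef) : meanFormula f A B = meanFormula g A B := by
  rw [meanFormula, meanFormula, cfc_congr fun x hx =>
    hfg x (spectrum_subset_of_posDef (posDef_conj_inv_matSqrt hA hB) hx)]

theorem meanApprox_rpow_one_sub {n : ℕ} (α : ℝ) {A B : Mat n} (hA : A.PosSemidef)
    (hB : B.PosSemidef) : meanApprox (fun t => t ^ (1 - α)) A B =ᶠ[𝓝[>] (0 : ℝ)]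
      meanApprox (fun t => t ^ α) B A := by
  filter_upwards [self_mem_nhdsWithin] with ε hε
  have hA' := posDef_add_smul_one hA hε
  have hB' := posDef_add_smul_one hB hε
  rw [meanApprox, meanApprox, meanFormula_swap _ hA' hB']
  refine meanFormula_congr (fun t ht => ?_) hA' hB'
  rw [Real.rpow_sub ht, Real.rpow_one, Real.inv_rpow ht.le, div_eq_mul_inv]

/-- The transpose of `♯_α` is `♯_{1-α}`. -/
theorem geomMean_one_sub {n : ℕ} (α : ℝ) {A B : Mat n} (hA : A.PosSemidef)
    (hB : B.PosSemidef) : geomMean (1 - α) A B = matrixMean (fun t => t ^ α) B A :=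
  congrArg lim (Filter.map_congr (meanApprox_rpow_one_sub α hA hB))

theorem mainTheorem4 {q p : ℕ} (Φ : Mat q →ₗ[ℂ] Mat q →ₗ[ℂ] Mat p)
    (hΦ : IsPositiveBilinear Φ) (hΦ_unital : Φ 1 1 = 1)
    (A B : Mat q) (hA : A.PosSemidef) (hB : B.PosSemidef) :
    (∀ f : ℝ → ℝ, IsRepresentingFunction f → IsSuperMultiplicativeOn f (Ioi 0) →
      ¬ IsAffineOn f (Ioi 0) →
        MeanConverges f A B ∧ MeanConverges f B A ∧
        Φ (matrixMean f A B) (transposeMean f A B) + Φ (transposeMean f A B) (matrixMean f A B)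
          ≤ Φ A B + Φ B A) ∧
    (∀ α : ℝ, α ∈ Icc (0 : ℝ) 1 →
        MeanConverges (fun t => t ^ α) A B ∧ MeanConverges (fun t => t ^ (1 - α)) A B ∧
        Φ (geomMean α A B) (geomMean (1 - α) A B) + Φ (geomMean (1 - α) A B) (geomMean α A B)
          ≤ Φ A B + Φ B A) := by
  refine ⟨fun f hf hm _ => ⟨hf.meanConverges hm.continuousOn hA hB,
    hf.meanConverges hm.continuousOn hB hA, hΦ.matrixMean_le hf hm hA hB⟩, fun α hα => ?_⟩
  have hα' : 1 - α ∈ Icc (0 : ℝ) 1 := ⟨by linarith [hα.2], by linarith [hα.1]⟩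
  refine ⟨(isRepresentingFunction_rpow hα).meanConverges
      (isSuperMultiplicativeOn_rpow α).continuousOn hA hB,
    (isRepresentingFunction_rpow hα').meanConverges
      (isSuperMultiplicativeOn_rpow (1 - α)).continuousOn hA hB, ?_⟩
  rw [geomMean_one_sub α hA hB]
  exact hΦ.matrixMean_le (isRepresentingFunction_rpow hα) (isSuperMultiplicativeOn_rpow α) hA hB
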